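/- \textbf{Theorem.} The $\mathbb N$-synthesis problem for the interval temporal logic $AB\bar B$, defined as follows, is undecidable (no algorithm decides which pairs $(\varphi,\Sigma^T_\square)$ are positive instances). \emph{Logic.} Formulas are built from countably many proposition letters with $\neg$, $\vee$, $\langle A\rangle$, $\langle B\rangle$, $\langle\bar B\rangle$. They are interpreted on the intervals $[x,y]$, $x\le y$, of an interval structure $(\mathbb N,\mathcal V)$, where $\mathcal V$ assigns to each interval a set of letters: $\langle A\rangle\psi$ holds on $[x,y]$ iff $\psi$ holds on some $[y,z]$; $\langle B\rangle\psi$ iff $\psi$ holds on some $[x,z]$ with $z<y$; $\langle\bar B\rangle\psi$ iff $\psi$ holds on some $[x,z]$ with $z>y$. \emph{Items.} For a formula $\varphi$, let $\Sigma$ be the set of its letters, let the closure of $\varphi$ be the set of its subformulas and their negations (with $\neg\neg\psi$ identified with $\psi$), let $TF^+(\varphi)$ be the set of temporal requests $\langle R\rangle\psi$ with $R\in\{A,B,\bar B\}$ and $\psi$ in the closure, and let $\Sigma^T=\Sigma\cup TF^+(\varphi)$. An input is a pair $(\varphi,\Sigma^T_\square)$ with $\Sigma^T_\square\subseteq\Sigma^T$.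 \emph{Admissible runs.} An (infinite) admissible run is a sequence $\rho=([x_i,y_i],\sigma_i)_{i\in\mathbb N}$ such that $[x_0,y_0]=[0,0]$; for every even $i$, $[x_i,y_i]=[x_{i+1},y_{i+1}]$, $\sigma_i\subseteq\Sigma^T_\square$ (Spoiler's move) and $\sigma_{i+1}\subseteq\Sigma^T\setminus\Sigma^T_\square$ (Duplicator's move), and no other position carries the interval $[x_i,y_i]$; every interval over $\mathbb N$ occurs; and whenever $y_{i+1}\ne y_i$, then $y_{i+1}=y_i+1$ and every $[x,y]$ with $y<y_{i+1}$ occurs at some position at most $i$. The label of an interval in $\rho$ is $\sigma_i\cup\sigma_{i+1}$, where $i$ is the even position at which it occurs; the letters in the labels form the valuation of the induced structure $\mathbf M_\rho$ over $\mathbb N$. \emph{Winning.} The run $\rho$ is successful if $\mathbf M_\rho,[0,0]\models\varphi$ and, for every temporal request $\psi\in TF^+(\varphi)\cap\Sigma^T_\square$ and every interval $I$, $\mathbf M_\rho,I\models\psi$ iff $\psi$ belongs to the label of $I$. (The truth values of the requests not controlled by Spoiler are determined by $\mathbf M_\rho$, and Duplicator is not required to announce them during the play.) A response strategy assigns to each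 finite prefix of odd length of an admissible run a subset of $\Sigma^T\setminus\Sigma^T_\square$. The pair $(\varphi,\Sigma^T_\square)$ is a positive instance if there is a response strategy such that, for every sequence of Spoiler's moves (the even positions of an admissible run), the run in which Duplicator answers with the strategy is a successful admissible run. -/

import Mathlib

/-- Formulas of the interval temporal logic ABB, over the countable supply `ℕ` of proposition
letters: Boolean connectives and the modalities `⟨A⟩` (meets), `⟨B⟩` (begun by) and
`⟨B̄⟩` (begins). -/
inductive ABBFormula : Type
  | letter : ℕ → ABBFormula
  | neg : ABBFormula → ABBFormula
  | disj : ABBFormula → ABBFormula → ABBFormula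
  | diaA : ABBFormula → ABBFormula
  | diaB : ABBFormula → ABBFormula
  | diaBbar : ABBFormula → ABBFormula

namespace ABBFormula

/-! ### Formulas as inputs of algorithms -/

/-- A standard Gödel numbering of formulas; it is a bijection onto `ℕ`. -/
def code : ABBFormula → ℕ
  | letter p => 6 * p
  | neg φ => 6 * code φ + 1
  | disj φ ψ => 6 * Nat.pair (code φ) (code ψ) + 2
  | diaA φ => 6 * code φ + 3
  | diaB φ => 6 * code φ + 4
  | diaBbar φ => 6 * code φ + 5

/-- The formula with a given Gödel number. -/
def decode (n : ℕ) : ABBFormula :=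
  if _h0 : n % 6 = 0 then letter (n / 6)
  else if _h1 : n % 6 = 1 then neg (decode (n / 6))
  else if _h2 : n % 6 = 2 then
    disj (decode (Nat.unpair (n / 6)).1) (decode (Nat.unpair (n / 6)).2)
  else if _h3 : n % 6 = 3 then diaA (decode (n / 6))
  else if _h4 : n % 6 = 4 then diaB (decode (n / 6))
  else diaBbar (decode (n / 6))
termination_by n
decreasing_by
  all_goals
    have := Nat.unpair_left_le (n / 6)
    have := Nat.unpair_right_le (n / 6)
    omega

theorem decode_code (φ : ABBFormula) : decode (code φ) = φ := by
  induction φ with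
  | letter p =>
    rw [code, decode, dif_pos (by omega)]
    congr 1
    omega
  | neg φ ih =>
    rw [code, decode, dif_neg (by omega), dif_pos (by omega)]
    rw [show (6 * code φ + 1) / 6 = code φ by omega, ih]
  | disj φ ψ ih₁ ih₂ =>
    rw [code, decode, dif_neg (by omega), dif_neg (by omega), dif_pos (by omega)]
    rw [show (6 * Nat.pair (code φ) (code ψ) + 2) / 6 = Nat.pair (code φ) (code ψ) by omega,
      Nat.unpair_pair]
    simp only [ih₁, ih₂]
  | diaA φ ih =>
    rw [code, decode, dif_neg (by omega), dif_neg (by omega), dif_neg (by omega),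
      dif_pos (by omega)]
    rw [show (6 * code φ + 3) / 6 = code φ by omega, ih]
  | diaB φ ih =>
    rw [code, decode, dif_neg (by omega), dif_neg (by omega), dif_neg (by omega),
      dif_neg (by omega), dif_pos (by omega)]
    rw [show (6 * code φ + 4) / 6 = code φ by omega, ih]
  | diaBbar φ ih =>
    rw [code, decode, dif_neg (by omega), dif_neg (by omega), dif_neg (by omega),
      dif_neg (by omega), dif_neg (by omega)]
    rw [show (6 * code φ + 5) / 6 = code φ by omega, ih]

theorem code_decode (n : ℕ) : code (decode n) = n := by
  induction n using Nat.strong_induction_on with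
  | _ n ih =>
    have hl := Nat.unpair_left_le (n / 6)
    have hr := Nat.unpair_right_le (n / 6)
    rw [decode]
    split_ifs with h0 h1 h2 h3 h4
    · rw [code]; omega
    · rw [code, ih _ (by omega)]; omega
    · rw [code, ih _ (by omega), ih _ (by omega), Nat.pair_unpair]; omega
    · rw [code, ih _ (by omega)]; omega
    · rw [code, ih _ (by omega)]; omega
    · rw [code, ih _ (by omega)]; omega

/-- The Gödel numbering as a bijection. -/
def codeEquiv : ABBFormula ≃ ℕ where
  toFun := code
  invFun := decode
  left_inv := decode_code
  right_inv := code_decode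

instance : Primcodable ABBFormula := Primcodable.ofEquiv ℕ codeEquiv

/-! ### Semantics -/

/-- Truth of a formula on an interval `[x, y]`, `x ≤ y`, of the interval structure `(D, V)`
(non-strict semantics; `NonemptyInterval D` is the type of all closed intervals). -/
def Sat {D : Type*} [LinearOrder D] (V : NonemptyInterval D → Set ℕ) :
    NonemptyInterval D → ABBFormula → Prop
  | I, letter p => p ∈ V I
  | I, neg φ => ¬ Sat V I φ
  | I, disj φ ψ => Sat V I φ ∨ Sat V I ψ
  | I, diaA φ => ∃ J : NonemptyInterval D, I.snd = J.fst ∧ Sat V J φ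
  | I, diaB φ => ∃ J : NonemptyInterval D, I.fst = J.fst ∧ J.snd < I.snd ∧ Sat V J φ
  | I, diaBbar φ => ∃ J : NonemptyInterval D, I.fst = J.fst ∧ I.snd < J.snd ∧ Sat V J φ

/-! ### Closure, temporal requests -/

/-- The set of subformulas. -/
def subformulas : ABBFormula → Set ABBFormula
  | letter p => {letter p}
  | neg φ => insert (neg φ) (subformulas φ)
  | disj φ ψ => insert (disj φ ψ) (subformulas φ ∪ subformulas ψ)
  | diaA φ => insert (diaA φ) (subformulas φ)
  | diaB φ => insert (diaB φ) (subformulas φ)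
  | diaBbar φ => insert (diaBbar φ) (subformulas φ)

/-- Negation, where `¬¬ψ` is identified with `ψ`. -/
def negate : ABBFormula → ABBFormula
  | neg φ => φ
  | φ => neg φ

/-- The closure of `φ`: its subformulas and their negations. -/
def closure (φ : ABBFormula) : Set ABBFormula :=
  subformulas φ ∪ negate '' subformulas φ

/-- The temporal requests of `φ`: all `⟨R⟩ψ` with `R ∈ {A, B, B̄}` and `ψ` in the closure. -/
def requests (φ : ABBFormula) : Set ABBFormula :=
  diaA '' closure φ ∪ diaB '' closure φ ∪ diaBbar '' closure φ

/-- The proposition letters occurring in `φ`, as formulas. -/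
def letters (φ : ABBFormula) : Set ABBFormula :=
  {ψ | ψ ∈ subformulas φ ∧ ∃ p, ψ = letter p}

/-- The items that are distributed among the two players: letters and temporal requests. -/
def items (φ : ABBFormula) : Set ABBFormula :=
  letters φ ∪ requests φ

end ABBFormula

namespace ABBSynthesis

/-- A move: an interval over `ℕ` together with a set of letters and temporal requests (those
of the moving player's items that are declared true on the interval). -/
abbrev Move : Type := NonemptyInterval ℕ × Set ABBFormula

/-- Infinite admissible runs on `(φ, Sp)`, where `Sp` is the set of Spoiler's items: Spoiler
moves at even positions, Duplicator completes the labeling of the same interval at the next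
odd position. -/
structure IsAdmissibleRun (φ : ABBFormula) (Sp : Set ABBFormula) (ρ : ℕ → Move) : Prop where
  /-- every interval is visited -/
  visited : ∀ I : NonemptyInterval ℕ, ∃ i, (ρ i).1 = I
  /-- the first interval is `[0, 0]` -/
  start : (ρ 0).1 = NonemptyInterval.pure 0
  same_interval : ∀ i, Even i → (ρ i).1 = (ρ (i + 1)).1
  spoiler_label : ∀ i, Even i → (ρ i).2 ⊆ Sp
  duplicator_label : ∀ i, Even i → (ρ (i + 1)).2 ⊆ φ.items \ Sp
  /-- every interval is visited by one round only -/
  once : ∀ i, Even i → ∀ j, j ≠ i → j ≠ i + 1 → (ρ i).1 ≠ (ρ j).1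
  /-- right endpoints grow one by one, and only after everything to the left is visited -/
  order : ∀ i, (ρ (i + 1)).1.snd ≠ (ρ i).1.snd →
    (ρ (i + 1)).1.snd = (ρ i).1.snd + 1 ∧
      ∀ I : NonemptyInterval ℕ, I.snd < (ρ (i + 1)).1.snd → ∃ j < i + 1, (ρ j).1 = I

/-- The sequences of Spoiler's moves (even positions) in admissible runs. -/
def IsSpoilerRun (φ : ABBFormula) (Sp : Set ABBFormula) (ρS : ℕ → Move) : Prop :=
  ∃ ρ, IsAdmissibleRun φ Sp ρ ∧ ∀ i, ρ (2 * i) = ρS i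

/-- A response strategy: it maps the finite sequence of the moves made so far, the last one by
Spoiler, to a set of Duplicator's items. Its values on sequences that are not prefixes of
odd length of admissible runs play no role. -/
def IsStrategy (φ : ABBFormula) (Sp : Set ABBFormula) (S : List Move → Set ABBFormula) : Prop :=
  ∀ h, S h ⊆ φ.items \ Sp

/-- The first `2 * i` moves of the play in which Spoiler plays `ρS` and Duplicator follows `S`. -/
def history (S : List Move → Set ABBFormula) (ρS : ℕ → Move) : ℕ → List Move
  | 0 => []
  | i + 1 => history S ρS i ++ [ρS i, ((ρS i).1, S (history S ρS i ++ [ρS i]))]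

/-- The response of the strategy `S` to Spoiler's sequence `ρS`: position `2 * i` is `ρS i`,
and position `2 * i + 1` is the answer of `S` to the moves at positions `0, …, 2 * i`. -/
def response (S : List Move → Set ABBFormula) (ρS : ℕ → Move) (n : ℕ) : Move :=
  if n % 2 = 0 then ρS (n / 2)
  else ((ρS (n / 2)).1, S (history S ρS (n / 2) ++ [ρS (n / 2)]))

/-- All items declared true on the interval `I`, by either player, in the run `ρ`. -/
def labelOf (ρ : ℕ → Move) (I : NonemptyInterval ℕ) : Set ABBFormula :=
  {ψ | ∃ i, Even i ∧ (ρ i).1 = I ∧ (ψ ∈ (ρ i).2 ∨ ψ ∈ (ρ (i + 1)).2)}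

/-- The valuation of the interval structure over `ℕ` that is induced by a run. -/
def valuation (ρ : ℕ → Move) (I : NonemptyInterval ℕ) : Set ℕ :=
  {p | ABBFormula.letter p ∈ labelOf ρ I}

/-- Success of a run: `φ` is true on `[0, 0]` in the induced structure, and the temporal
requests that were declared by Spoiler have their actual truth values there. Duplicator's
entries for the remaining requests are mere annotations: the truth values of these requests
are determined by the induced structure, and she need not announce them in advance. -/
def IsSuccessful (φ : ABBFormula) (Sp : Set ABBFormula) (ρ : ℕ → Move) : Prop :=
  ABBFormula.Sat (valuation ρ) (NonemptyInterval.pure 0) φ ∧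
    ∀ I, ∀ ψ ∈ φ.requests, ψ ∈ Sp →
      (ABBFormula.Sat (valuation ρ) I ψ ↔ ψ ∈ labelOf ρ I)

/-- `(φ, Sp)` admits an `ℕ`-synthesis: some response strategy answers every sequence of
Spoiler's moves with a successful admissible run. -/
def AdmitsSynthesis (φ : ABBFormula) (Sp : Set ABBFormula) : Prop :=
  ∃ S, IsStrategy φ Sp S ∧ ∀ ρS, IsSpoilerRun φ Sp ρS →
    IsAdmissibleRun φ Sp (response S ρS) ∧ IsSuccessful φ Sp (response S ρS)

/-- The positive instances of the `ℕ`-synthesis problem for ABB. The input is a formula and a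
list of Spoiler's items, which must be letters or temporal requests of the formula. -/
def PositiveInstance (i : ABBFormula × List ABBFormula) : Prop :=
  (∀ ψ ∈ i.2, ψ ∈ i.1.items) ∧ AdmitsSynthesis i.1 {ψ | ψ ∈ i.2}

end ABBSynthesis

/-! Non-halting of a fixed two-stack machine reduces to synthesis. Column `y` consists of the
intervals `[x, y]`. Duplicator writes a configuration there: the control state on `[0, y]` and cell
`x` of both stacks on `[x, y]`, with successive columns showing successive configurations. A push
lengthens the used part of a stack by at most one cell, and the next column has one more interval,
so the stacks always fit.

Checking a transition means comparing neighbouring rows in the same column, and for this the column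
has to be marked. Spoiler marks it: his only item is the letter `0`, and putting it on some `[y, z]`
challenges column `y`, since `⟨A⟩0` holds on exactly the intervals that end at a challenged point.
If a single column is challenged, `runFormula` asks that it continues the column before it, and that
column `n`, if it is the one, is initial.

The game turns this local check into a global one. The interval `[y, y + 1]` belongs to column `y +
1`, so Spoiler can wait until column `y` is complete before challenging it. In a play by columns,
Duplicator's answers to a Spoiler who never challenges must therefore withstand every later
challenge (`exists_labeling_of_admitsSynthesis`). All transitions in this one labeling are then
correct, and `Shows.exists_step` never lets the computation stop. Conversely, a labeling that shows
an infinite run wins against every Spoiler (`admitsSynthesis_of_not_halts`).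

The undecidable halting problem is obtained by compiling partial recursive functions down to
Post-Turing machines. Inputs `2 ^ n` are used because their binary code is a block of `n` equal
symbols with a fixed end, so `n` enters the formula only as a length. -/

/-! ### Two-stack machines -/

/-- An action of a two-stack machine: either change the control state, or pop a symbol from stack
`d`, push `s` onto the other stack and enter a control state depending on the popped symbol. -/
inductive StackAction (κ Γ : Type) : Type
  | stay : κ → StackAction κ Γ
  | move : Bool → Γ → (Γ → κ) → StackAction κ Γ

namespace StackMachine

variable {κ Γ : Type}

/-- Configurations: the control state and two infinite stacks. -/
abbrev Cfg (κ Γ : Type) : Type := κ × (Bool → ℕ → Γ)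

/-- Pop from stack `d` and push `s` onto the other stack. -/
def shift (d : Bool) (s : Γ) (T : Bool → ℕ → Γ) (e : Bool) (x : ℕ) : Γ :=
  if e = d then T e (x + 1) else Nat.casesOn x s (T e)

/-- The step function of a two-stack machine. -/
def step (δ : κ → Option (StackAction κ Γ)) (c : Cfg κ Γ) : Option (Cfg κ Γ) :=
  (δ c.1).map fun
    | .stay k => (k, c.2)
    | .move d s f => (f (c.2 d 0), shift d s c.2)

/-- The stacks on input `n`: the second stack holds `r` followed by `n` copies of `a`. -/
def initStacks (b r a : Γ) (n : ℕ) (d : Bool) (x : ℕ) : Γ :=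
  if d = true then (if x = 0 then r else if x ≤ n then a else b) else b

/-- Halting of a two-stack machine. -/
def Halts (δ : κ → Option (StackAction κ Γ)) (c : Cfg κ Γ) : Prop :=
  (StateTransition.eval (step δ) c).Dom

theorem not_halts_iff_exists_run (δ : κ → Option (StackAction κ Γ)) (c₀ : Cfg κ Γ) :
    ¬ Halts δ c₀ ↔ ∃ c : ℕ → Cfg κ Γ, c 0 = c₀ ∧ ∀ t, step δ (c t) = some (c (t + 1)) := by
  constructor
  · intro h
    have H : ∀ c : Cfg κ Γ, StateTransition.Reaches (step δ) c₀ c →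
        ∃ c', step δ c = some c' := by
      intro c hc
      by_contra! hn
      have hmem : c ∈ StateTransition.eval (step δ) c₀ :=
        StateTransition.mem_eval.2 ⟨hc, Option.eq_none_iff_forall_ne_some.2 hn⟩
      exact h (Part.dom_iff_mem.2 ⟨c, hmem⟩)
    choose! next hnext using H
    have hreach : ∀ t, StateTransition.Reaches (step δ) c₀ (next^[t] c₀) := by
      intro t
      induction t with
      | zero => exact Relation.ReflTransGen.refl
      | succ t ih =>
        rw [Function.iterate_succ_apply']
        exact ih.tail (hnext _ ih)
    refine ⟨fun t => next^[t] c₀, rfl, fun t => ?_⟩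
    dsimp only
    rw [Function.iterate_succ_apply']
    exact hnext _ (hreach t)
  · rintro ⟨c, h0, hc⟩ hd
    obtain ⟨b, hb⟩ := Part.dom_iff_mem.1 hd
    obtain ⟨hr, hn⟩ := StateTransition.mem_eval.1 hb
    have : ∃ t, b = c t := by
      clear hn hb
      induction hr with
      | refl => exact ⟨0, h0.symm⟩
      | tail _ h ih =>
        obtain ⟨t, rfl⟩ := ih
        exact ⟨t + 1, Option.some_injective _ ((Option.mem_def.1 h).symm.trans (hc t))⟩
    obtain ⟨t, rfl⟩ := this
    simp [hc t] at hn

/-! ### Post-Turing machines as two-stack machines -/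

section TM0

open Turing

variable {Λ : Type} [Inhabited Λ] [Inhabited Γ]

open Classical in
/-- The two-stack machine of a Post-Turing machine with states in `S`. -/
noncomputable def ofTM0 (M : TM0.Machine Γ Λ) (S : Finset Λ) (k : S × Γ) :
    Option (StackAction (S × Γ) Γ) :=
  (M k.1 k.2).map fun p =>
    -- The alternative is never used from a supported state, because `S` is closed under
    -- transitions.
    let q : S := if h : p.1 ∈ S then ⟨p.1, h⟩ else k.1
    match p.2 with
    | .write a => .stay (q, a)
    | .move Dir.right => .move true k.2 fun a => (q, a)
    | .move Dir.left => .move false k.2 fun a => (q, a)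

/-- The two-stack configuration of a Post-Turing configuration. -/
def cfgOfTM0 (S : Finset Λ) (c : TM0.Cfg Γ Λ) (h : c.q ∈ S) : Cfg (S × Γ) Γ :=
  ((⟨c.q, h⟩, c.Tape.head), fun d => if d = true then c.Tape.right.nth else c.Tape.left.nth)

/-- One machine step corresponds to one step here: the scanned symbol lives in the control state,
and moving the head pushes it onto one stack and pops its replacement from the other. -/
theorem halts_cfgOfTM0 {M : TM0.Machine Γ Λ} {S : Finset Λ} (hS : TM0.Supports M (S : Set Λ))
    (c : TM0.Cfg Γ Λ) (h : c.q ∈ S) :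
    Halts (ofTM0 M S) (cfgOfTM0 S c h) ↔ (StateTransition.eval (TM0.step M) c).Dom := by
  refine StateTransition.tr_eval_dom
    (tr := fun c c' => ∃ h : c.q ∈ S, cfgOfTM0 S c h = c') ?_ ⟨h, rfl⟩
  rintro ⟨q, T⟩ _ ⟨h, rfl⟩
  simp only at h
  rcases e : M q T.head with _ | ⟨q', a⟩
  · have h1 : TM0.step M ⟨q, T⟩ = none := by simp [TM0.step, e]
    rw [h1]
    simp [step, ofTM0, cfgOfTM0, e]
  · have hq' : q' ∈ S := hS.2 (by rw [e]; rfl) h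
    rcases a with d | a
    · have h1 : TM0.step M ⟨q, T⟩ = some ⟨q', T.move d⟩ := by simp [TM0.step, e]
      rw [h1]
      refine ⟨_, ⟨hq', rfl⟩, Relation.TransGen.single ?_⟩
      rcases T with ⟨s, L, R⟩
      cases d
      · simp only [step, ofTM0, cfgOfTM0, e, hq', Option.map_some, Option.mem_def, dif_pos,
          Tape.move, Option.some.injEq, Prod.mk.injEq]
        refine ⟨⟨trivial, by simp⟩, ?_⟩
        funext d x
        cases d <;> cases x <;> simp [shift, ListBlank.nth_succ]
      · simp only [step, ofTM0, cfgOfTM0, e, hq', Option.map_some, Option.mem_def, dif_pos,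
          Tape.move, Option.some.injEq, Prod.mk.injEq]
        refine ⟨⟨trivial, by simp⟩, ?_⟩
        funext d x
        cases d <;> cases x <;> simp [shift, ListBlank.nth_succ]
    · have h1 : TM0.step M ⟨q, T⟩ = some ⟨q', T.write a⟩ := by simp [TM0.step, e]
      rw [h1]
      refine ⟨_, ⟨hq', rfl⟩, Relation.TransGen.single ?_⟩
      simp [step, ofTM0, cfgOfTM0, e, hq', Tape.write]

theorem cfgOfTM0_init {S : Finset Λ} (h : (default : Λ) ∈ S) (z y w : Γ) (n : ℕ) :
    cfgOfTM0 S (TM0.init (z :: y :: List.replicate n w)) h =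
      ((⟨default, h⟩, z), initStacks default y w n) := by
  refine Prod.ext rfl ?_
  funext d x
  cases d
  · simp [cfgOfTM0, TM0.init, Tape.mk₁, Tape.mk₂, Tape.mk', initStacks]
  · have hr : (cfgOfTM0 S (TM0.init (z :: y :: List.replicate n w)) h).2 true x =
        (y :: List.replicate n w).getI x := rfl
    rw [hr]
    cases x with
    | zero => rfl
    | succ x =>
      simp only [initStacks, List.getI_eq_getElem?_getD, Nat.succ_le_iff]
      split_ifs <;> simp_all

end TM0

/-! ### An undecidable halting problem -/

theorem exists_computable_logTwo : ∃ g : ℕ → ℕ, Computable g ∧ ∀ n, g (2 ^ n) = n := by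
  have hpow : Primrec fun k : ℕ => 2 ^ k :=
    (Primrec.nat_rec₁ (f := fun _ m => 2 * m) 1
      (Primrec.nat_double.comp Primrec.snd)).of_eq fun n => by
        induction n with
        | zero => rfl
        | succ n ih => simp only [ih, pow_succ']
  refine ⟨fun m => m.findGreatest fun k => 2 ^ k ≤ m, Primrec.to_comp
    (Primrec.nat_findGreatest (p := fun m k => 2 ^ k ≤ m) Primrec.id
      -- The search bound `m` suffices because `k < 2 ^ k`.
      (Primrec.nat_le.comp (hpow.comp Primrec.snd) Primrec.fst)), fun n => ?_⟩
  refine le_antisymm ?_ (Nat.le_findGreatest Nat.lt_two_pow_self.le le_rfl)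
  have h := Nat.findGreatest_spec (P := fun k => 2 ^ k ≤ 2 ^ n) (n := 2 ^ n)
    Nat.lt_two_pow_self.le le_rfl
  exact (Nat.pow_le_pow_iff_right (by norm_num)).1 h

-- Halting of program `p` on `0` is encoded at the argument `2 ^ p`; the computable logarithm
-- recovers `p`.
open Turing in
theorem exists_code_not_computable : ∃ c : ToPartrec.Code,
    ¬ ComputablePred fun n : ℕ => (c.eval [2 ^ n]).Dom := by
  obtain ⟨g, hg, hgpow⟩ := exists_computable_logTwo
  let f : ℕ →. ℕ := fun m => Nat.Partrec.Code.eval (Denumerable.ofNat Nat.Partrec.Code (g m)) 0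
  have hf : Partrec f :=
    Nat.Partrec.Code.eval_part.comp ((Computable.ofNat _).comp hg) (Computable.const 0)
  obtain ⟨c, hc⟩ := ToPartrec.Code.exists_code (Nat.Partrec'.part_iff₁.2 hf)
  refine ⟨c, fun h => ComputablePred.halting_problem 0 ?_⟩
  refine ComputablePred.computable_of_manyOneReducible ⟨Encodable.encode, Computable.encode,
    fun p => ?_⟩ h
  have := hc ⟨[2 ^ Encodable.encode p], rfl⟩
  simp only [List.Vector.head] at this
  rw [this]
  simp [f, hgpow, Part.map_Dom]

open Turing PartrecToTM2 in
theorem trList_two_pow (n : ℕ) :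
    trList [2 ^ n] = List.replicate n Γ'.bit0 ++ [Γ'.bit1, Γ'.cons] := by
  have : ∀ n : ℕ, ∃ p : PosNum, ((2 ^ n : ℕ) : Num) = Num.pos p ∧
      trPosNum p = List.replicate n Γ'.bit0 ++ [Γ'.bit1] := by
    intro n
    induction n with
    | zero => exact ⟨1, rfl, rfl⟩
    | succ n ih =>
      obtain ⟨p, hp, hl⟩ := ih
      refine ⟨p.bit0, ?_, by simp [trPosNum, hl, List.replicate_succ]⟩
      rw [pow_succ, mul_two, Nat.cast_add, hp]
      exact Num.bit0_of_bit0 (Num.pos p)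
  obtain ⟨p, hp, hl⟩ := this n
  simp only [trList, trNat, hp, trNum, hl]
  simp

open Turing in
/-- A multi-stack machine on inputs of the form `w, …, w, y, z` is simulated by a two-stack
machine. -/
theorem exists_halts_iff_TM2_eval_dom {K A Λ σ : Type} [DecidableEq K] [Fintype K] [Fintype A]
    [Inhabited Λ] [Fintype σ] [Inhabited σ] (M : Λ → TM2.Stmt (fun _ : K => A) Λ σ)
    (S : Finset Λ) (hS : TM2.Supports M S) (k : K) (w y z : A) :
    ∃ (κ Γ : Type) (_ : Fintype κ) (_ : Fintype Γ) (δ : κ → Option (StackAction κ Γ)) (k₀ : κ)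
      (b r a : Γ), ∀ n, Halts δ (k₀, initStacks b r a n) ↔
        (TM2.eval M k (List.replicate n w ++ [y, z])).Dom := by
  have hS₀ := TM1to0.tr_supports _ (TM2to1.tr_supports M hS)
  set S₀ := TM1to0.trStmts (TM2to1.tr M) (TM2to1.trSupp M S)
  let sym : A → TM2to1.Γ' K (fun _ => A) := fun g =>
    (false, Function.update (fun _ => none) k (some g))
  refine ⟨S₀ × TM2to1.Γ' K (fun _ => A), TM2to1.Γ' K (fun _ => A), inferInstance, inferInstance,
    ofTM0 (TM1to0.tr (TM2to1.tr M)) S₀, (⟨default, hS₀.1⟩, (true, (sym z).2)), default,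
    sym y, sym w, fun n => ?_⟩
  have hinit : TM2to1.trInit k (List.replicate n w ++ [y, z]) =
      (true, (sym z).2) :: sym y :: List.replicate n (sym w) := by
    have : (List.replicate n w ++ [y, z]).reverse = z :: y :: List.replicate n w := by simp
    have hmap : List.map sym (z :: y :: List.replicate n w) =
        sym z :: sym y :: List.replicate n (sym w) := by simp
    rw [TM2to1.trInit, this]
    change (true, (List.map sym _).headI.2) :: (List.map sym _).tail = _
    rw [hmap]
    rfl
  have hcfg := cfgOfTM0_init hS₀.1 (true, (sym z).2) (sym y) (sym w) n
  rw [← hinit] at hcfg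
  refine (Iff.of_eq (congrArg (Halts _) hcfg.symm)).trans ?_
  exact (halts_cfgOfTM0 hS₀ _ _).trans ((Iff.of_eq (congrArg Part.Dom (TM1to0.tr_eval (TM2to1.tr M)
    (TM2to1.trInit k (List.replicate n w ++ [y, z]))))).trans (TM2to1.tr_eval_dom M k _))

open Turing PartrecToTM2 in
/-- There is a two-stack machine whose halting problem is undecidable. -/
theorem exists_not_computable_halts : ∃ (κ Γ : Type) (_ : Fintype κ) (_ : Fintype Γ)
    (δ : κ → Option (StackAction κ Γ)) (k₀ : κ) (b r a : Γ),
    ¬ ComputablePred fun n : ℕ => Halts δ (k₀, initStacks b r a n) := by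
  obtain ⟨c, hc⟩ := exists_code_not_computable
  -- The default label is the start label, so it has to be the entry point of the code `c`.
  let _ : Inhabited Λ' := ⟨trNormal c Cont'.halt⟩
  let _ : Fintype K' := ⟨{.main, .rev, .aux, .stack}, fun k => by cases k <;> decide⟩
  obtain ⟨κ, Γ, i₁, i₂, δ, k₀, b, r, a, h⟩ := exists_halts_iff_TM2_eval_dom tr
    (codeSupp c Cont'.halt) (tr_supports c Cont'.halt) K'.main Γ'.bit0 Γ'.bit1 Γ'.cons
  refine ⟨κ, Γ, i₁, i₂, δ, k₀, b, r, a, fun hn => hc (hn.of_eq fun n => (h n).trans ?_)⟩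
  have hinit : TM2.init K'.main (List.replicate n Γ'.bit0 ++ [Γ'.bit1, Γ'.cons]) =
      PartrecToTM2.init c [2 ^ n] := by
    rw [← trList_two_pow]
    refine congrArg (TM2.Cfg.mk _ _) ?_
    funext k
    cases k <;> rfl
  exact (Iff.of_eq (congrArg (fun c => (StateTransition.eval (TM2.step tr) c).Dom) hinit)).trans
    (Iff.of_eq (congrArg Part.Dom (PartrecToTM2.tr_eval c [2 ^ n])))

end StackMachine

/-! ### Truth depends only on the letters of the formula -/

namespace ABBFormula

theorem self_mem_subformulas (φ : ABBFormula) : φ ∈ subformulas φ := by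
  cases φ <;> simp [subformulas]

theorem sat_congr {D : Type*} [LinearOrder D] {V W : NonemptyInterval D → Set ℕ} (φ : ABBFormula)
    (h : ∀ p, letter p ∈ subformulas φ → ∀ I, p ∈ V I ↔ p ∈ W I) (I : NonemptyInterval D) :
    Sat V I φ ↔ Sat W I φ := by
  induction φ generalizing I with
  | letter p => exact h p (self_mem_subformulas _) I
  | neg φ ih => exact not_congr (ih (fun p hp => h p (Or.inr hp)) I)
  | disj φ ψ ih₁ ih₂ =>
    exact or_congr (ih₁ (fun p hp => h p (Or.inr (Or.inl hp))) I)
      (ih₂ (fun p hp => h p (Or.inr (Or.inr hp))) I)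
  | diaA φ ih =>
    exact exists_congr fun J => and_congr_right fun _ => ih (fun p hp => h p (Or.inr hp)) J
  | diaB φ ih =>
    exact exists_congr fun J => and_congr_right fun _ => and_congr_right fun _ =>
      ih (fun p hp => h p (Or.inr hp)) J
  | diaBbar φ ih =>
    exact exists_congr fun J => and_congr_right fun _ => and_congr_right fun _ =>
      ih (fun p hp => h p (Or.inr hp)) J

theorem letter_notMem_requests (p : ℕ) (φ : ABBFormula) : letter p ∉ requests φ := by
  simp [requests]

end ABBFormula

namespace ABBSynthesis

open ABBFormula

variable {φ : ABBFormula} {Sp : Set ABBFormula} {S : List Move → Set ABBFormula} {ρS : ℕ → Move}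

/-! ### Plays that follow a strategy -/

theorem response_two_mul (S : List Move → Set ABBFormula) (ρS : ℕ → Move) (i : ℕ) :
    response S ρS (2 * i) = ρS i := by
  rw [response, if_pos (by omega)]
  congr 1
  omega

theorem response_two_mul_add_one (S : List Move → Set ABBFormula) (ρS : ℕ → Move) (i : ℕ) :
    response S ρS (2 * i + 1) = ((ρS i).1, S (history S ρS i ++ [ρS i])) := by
  rw [response, if_neg (by omega), show (2 * i + 1) / 2 = i by omega]

theorem isAdmissibleRun_response (hS : IsStrategy φ Sp S) (hρ : IsSpoilerRun φ Sp ρS) :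
    IsAdmissibleRun φ Sp (response S ρS) := by
  obtain ⟨ρ, h, e⟩ := hρ
  have hfst : ∀ n, (response S ρS n).1 = (ρ n).1 := by
    intro n
    obtain ⟨i, rfl | rfl⟩ := n.even_or_odd'
    · rw [response_two_mul, e]
    · rw [response_two_mul_add_one, ← h.same_interval _ (even_two_mul i), e]
  refine ⟨by simpa only [hfst] using h.visited, by simpa only [hfst] using h.start,
    by simpa only [hfst] using h.same_interval, fun i hi => ?_, fun i hi => ?_,
    by simpa only [hfst] using h.once, by simpa only [hfst] using h.order⟩
  · obtain ⟨j, rfl⟩ := even_iff_two_dvd.1 hi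
    rw [response_two_mul, ← e]
    exact h.spoiler_label _ hi
  · obtain ⟨j, rfl⟩ := even_iff_two_dvd.1 hi
    rw [response_two_mul_add_one]
    exact hS _

theorem mem_labelOf_response {I : NonemptyInterval ℕ} {ψ : ABBFormula} :
    ψ ∈ labelOf (response S ρS) I ↔ ∃ i, (ρS i).1 = I ∧
      (ψ ∈ (ρS i).2 ∨ ψ ∈ S (history S ρS i ++ [ρS i])) := by
  constructor
  · rintro ⟨i, hi, h⟩
    obtain ⟨j, rfl⟩ := even_iff_two_dvd.1 hi
    rw [response_two_mul, response_two_mul_add_one] at h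
    exact ⟨j, h⟩
  · rintro ⟨i, h⟩
    refine ⟨2 * i, even_two_mul i, ?_⟩
    rwa [response_two_mul, response_two_mul_add_one]

theorem history_congr {ρS' : ℕ → Move} {i : ℕ} (h : ∀ j < i, ρS j = ρS' j) :
    history S ρS i = history S ρS' i := by
  induction i with
  | zero => rfl
  | succ i ih =>
    rw [history, history, ih fun j hj => h j (by omega), h i (by omega)]

theorem IsSpoilerRun.exists_fst_eq (hρ : IsSpoilerRun φ Sp ρS) (I : NonemptyInterval ℕ) :
    ∃ i, (ρS i).1 = I := by
  obtain ⟨ρ, h, e⟩ := hρ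
  obtain ⟨n, hn⟩ := h.visited I
  obtain ⟨i, rfl | rfl⟩ := n.even_or_odd'
  · exact ⟨i, by rw [← e, hn]⟩
  · exact ⟨i, by rw [← e, h.same_interval _ (even_two_mul i), hn]⟩

theorem IsSpoilerRun.snd_subset (hρ : IsSpoilerRun φ Sp ρS) (i : ℕ) : (ρS i).2 ⊆ Sp := by
  obtain ⟨ρ, h, e⟩ := hρ
  rw [← e]
  exact h.spoiler_label _ (even_two_mul i)

/-- If Duplicator has a labeling that makes `φ` true whatever Spoiler does with the letter `0`,
then she wins by playing that labeling. -/
theorem admitsSynthesis_of_labeling (D : NonemptyInterval ℕ → Set ℕ)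
    (H : ∀ V : NonemptyInterval ℕ → Set ℕ, (∀ I p, p ≠ 0 → (p ∈ V I ↔ p ∈ D I)) →
      Sat V (NonemptyInterval.pure 0) φ) :
    AdmitsSynthesis φ {letter 0} := by
  let S : List Move → Set ABBFormula := fun h =>
    {ψ | ψ ∈ φ.items \ {letter 0} ∧ ∃ m ∈ h.getLast?, ∃ p ∈ D m.1, ψ = letter p}
  have hS : IsStrategy φ {letter 0} S := fun h ψ hψ => hψ.1
  refine ⟨S, hS, fun ρS hρ => ⟨isAdmissibleRun_response hS hρ, ?_, ?_⟩⟩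
  -- Duplicator may only play letters of `φ`, so the induced valuation can differ from `D` on other
  -- letters. It is replaced by one that takes letter `0` from the play and everything else from
  -- `D`.
  · refine (sat_congr (W := fun I => {p | if p = 0 then p ∈ valuation (response S ρS) I
      else p ∈ D I}) φ (fun p hp I => ?_) _).2 (H _ fun I p hp => by simp [hp])
    by_cases h0 : p = 0
    · simp [h0]
    · have hne : letter p ≠ letter 0 := fun h => h0 (by injection h)
      simp only [valuation, Set.mem_ofPred_eq, h0, if_false, mem_labelOf_response]
      constructor
      · rintro ⟨i, rfl, h | h⟩
        · exact absurd (hρ.snd_subset i h) hne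
        · obtain ⟨-, m, hm, q, hq, e⟩ := h
          simp only [List.getLast?_append, List.getLast?_singleton, Option.some_or,
            Option.mem_some_iff] at hm
          injection e with e
          rw [e, hm]
          exact hq
      · intro h
        obtain ⟨i, hi⟩ := hρ.exists_fst_eq I
        refine ⟨i, hi, Or.inr ⟨⟨Or.inl ⟨hp, p, rfl⟩, hne⟩, ρS i, by simp, p, ?_, rfl⟩⟩
        rw [hi]
        exact h
  -- Spoiler owns no temporal request, so this condition is vacuous.
  · rintro I ψ hψ rfl
    exact absurd hψ (letter_notMem_requests _ _)

/-! ### Visiting the intervals column by column -/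

/-- Triangular numbers. -/
def tri : ℕ → ℕ
  | 0 => 0
  | y + 1 => tri y + (y + 1)

theorem tri_mono : Monotone tri :=
  monotone_nat_of_le_succ fun _ => Nat.le_add_right _ _

/-- The position of an interval in the enumeration by columns. -/
def position (I : NonemptyInterval ℕ) : ℕ := tri I.snd + I.fst

/-- The enumeration of all intervals by right endpoints, then by left endpoints. -/
def enum : ℕ → NonemptyInterval ℕ
  | 0 => NonemptyInterval.pure 0
  | i + 1 =>
    if h : (enum i).fst < (enum i).snd then ⟨((enum i).fst + 1, (enum i).snd), h⟩
    else ⟨(0, (enum i).snd + 1), Nat.zero_le _⟩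

theorem position_enum (i : ℕ) : position (enum i) = i := by
  induction i with
  | zero => rfl
  | succ i ih =>
    have hle := (enum i).fst_le_snd
    rw [position] at ih
    rw [enum]
    split_ifs with h
    · simp only [position]
      omega
    · simp only [position, tri]
      omega

theorem position_lt_of_snd_lt {I J : NonemptyInterval ℕ} (h : I.snd < J.snd) :
    position I < position J := by
  have h1 := I.fst_le_snd
  have h2 : tri (I.snd + 1) ≤ tri J.snd := tri_mono h
  rw [tri] at h2
  rw [position, position]
  omega

theorem position_injective : Function.Injective position := by
  intro I J h
  rcases lt_trichotomy I.snd J.snd with h1 | h1 | h1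
  · exact absurd h (position_lt_of_snd_lt h1).ne
  · rw [position, position, h1] at h
    exact NonemptyInterval.ext (Prod.ext (by simpa using h) h1)
  · exact absurd h (position_lt_of_snd_lt h1).ne'

theorem enum_position (I : NonemptyInterval ℕ) : enum (position I) = I :=
  position_injective (position_enum _)

theorem enum_injective : Function.Injective enum :=
  Function.LeftInverse.injective position_enum

theorem enum_order {i : ℕ} (h : (enum (i + 1)).snd ≠ (enum i).snd) :
    (enum (i + 1)).snd = (enum i).snd + 1 := by
  rw [enum] at h ⊢
  split_ifs at h ⊢ with h1
  · exact absurd rfl h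
  · rfl

/-- Spoiler visits the intervals by columns, and labels those in `P` with the letter `0`. -/
def columnPlay (P : Set (NonemptyInterval ℕ)) (i : ℕ) : Move :=
  (enum i, {ψ | ψ = letter 0 ∧ enum i ∈ P})

theorem isSpoilerRun_columnPlay (φ : ABBFormula) (P : Set (NonemptyInterval ℕ)) :
    IsSpoilerRun φ {letter 0} (columnPlay P) := by
  refine ⟨fun n => (enum (n / 2), if n % 2 = 0 then (columnPlay P (n / 2)).2 else ∅),
    ⟨fun I => ⟨2 * position I, ?_⟩, rfl, ?_, ?_, ?_, ?_, ?_⟩, fun i => ?_⟩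
  · rw [Nat.mul_div_cancel_left _ two_pos, enum_position]
  · intro i hi
    have := Nat.even_iff.1 hi
    rw [show (i + 1) / 2 = i / 2 by omega]
  · intro i hi ψ hψ
    rw [if_pos (Nat.even_iff.1 hi)] at hψ
    exact hψ.1
  · intro i hi
    have := Nat.even_iff.1 hi
    rw [if_neg (by omega)]
    exact Set.empty_subset _
  · intro i hi j h1 h2 h
    have := Nat.even_iff.1 hi
    have := enum_injective h
    omega
  · intro i h
    dsimp only at h ⊢
    obtain ⟨m, rfl | rfl⟩ := i.even_or_odd'
    · rw [show (2 * m + 1) / 2 = 2 * m / 2 by omega] at h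
      exact absurd rfl h
    · rw [show (2 * m + 1 + 1) / 2 = m + 1 by omega, show (2 * m + 1) / 2 = m by omega] at h ⊢
      refine ⟨enum_order h, fun I hI => ⟨2 * position I, ?_, ?_⟩⟩
      · have := position_lt_of_snd_lt hI
        rw [position_enum] at this
        omega
      · rw [Nat.mul_div_cancel_left _ two_pos, enum_position]
  · simp [columnPlay]

/-- The interval `[y, y + 1]`. -/
def unitInterval (y : ℕ) : NonemptyInterval ℕ := ⟨(y, y + 1), Nat.le_succ y⟩

/-- A winning strategy of Duplicator yields one labeling whose restriction to the first columns
is a part of a model of `φ` in which the letter `0` marks the next column. -/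
theorem exists_labeling_of_admitsSynthesis (h : AdmitsSynthesis φ {letter 0}) :
    ∃ D : NonemptyInterval ℕ → Set ℕ, ∀ y, ∃ V : NonemptyInterval ℕ → Set ℕ,
      Sat V (NonemptyInterval.pure 0) φ ∧ (∀ I, 0 ∈ V I ↔ I = unitInterval y) ∧
      ∀ I p, p ≠ 0 → I.snd ≤ y → (p ∈ V I ↔ p ∈ D I) := by
  obtain ⟨S, hS, H⟩ := h
  have key : ∀ P I ψ, ψ ∈ labelOf (response S (columnPlay P)) I ↔
      ψ ∈ (columnPlay P (position I)).2 ∨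
        ψ ∈ S (history S (columnPlay P) (position I) ++ [columnPlay P (position I)]) := by
    intro P I ψ
    rw [mem_labelOf_response]
    constructor
    · rintro ⟨i, rfl, h⟩
      rwa [show position (columnPlay P i).1 = i from position_enum i]
    · exact fun h => ⟨position I, enum_position I, h⟩
  -- `D` collects the answers to the play without any challenge; `V` comes from the play that
  -- challenges column `y` as late as column `y + 1`.
  refine ⟨fun I => {p | letter p ∈ S (history S (columnPlay ∅) (position I) ++
    [columnPlay ∅ (position I)])}, fun y => ⟨valuation (response S (columnPlay {unitInterval y})),
    (H _ (isSpoilerRun_columnPlay φ _)).2.1, fun I => ?_, fun I p hp hI => ?_⟩⟩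
  · rw [valuation, Set.mem_ofPred_eq, key, or_iff_left fun h => (hS _ h).2 rfl]
    simp [columnPlay, enum_position]
  -- Both plays agree up to the end of column `y`, hence so do the histories that the strategy sees.
  · have hplay : ∀ j ≤ position I, columnPlay {unitInterval y} j = columnPlay ∅ j := by
      intro j hj
      have hne : enum j ≠ unitInterval y := by
        intro h
        have h1 : position I < position (unitInterval y) :=
          position_lt_of_snd_lt (Nat.lt_succ_of_le hI)
        rw [← h, position_enum] at h1
        omega
      simp [columnPlay, hne]
    rw [valuation, Set.mem_ofPred_eq, key, hplay _ le_rfl,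
      history_congr fun j hj => hplay j hj.le]
    exact or_iff_right fun h => by simp [columnPlay] at h

end ABBSynthesis

namespace ABBFormula

/-! ### Derived connectives -/

/-- Truth. -/
def top : ABBFormula := disj (letter 0) (neg (letter 0))

/-- Conjunction. -/
def conj (φ ψ : ABBFormula) : ABBFormula := neg (disj (neg φ) (neg ψ))

/-- Implication. -/
def imp (φ ψ : ABBFormula) : ABBFormula := disj (neg φ) ψ

/-- The dual of `⟨A⟩`. -/
def boxA (φ : ABBFormula) : ABBFormula := neg (diaA (neg φ))

/-- Finite conjunctions. -/
def bigConj : List ABBFormula → ABBFormula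
  | [] => top
  | φ :: l => conj φ (bigConj l)

/-- Conjunctions indexed by a finite type. -/
noncomputable def iConj {ι : Type} [Fintype ι] (F : ι → ABBFormula) : ABBFormula :=
  bigConj (Finset.univ.toList.map F)

section Sat

variable {D : Type*} [LinearOrder D] {V : NonemptyInterval D → Set ℕ} {I : NonemptyInterval D}
  {φ ψ : ABBFormula}

@[simp] theorem sat_top : Sat V I top := em _

@[simp] theorem sat_neg : Sat V I (neg φ) ↔ ¬ Sat V I φ := Iff.rfl

@[simp] theorem sat_disj : Sat V I (disj φ ψ) ↔ Sat V I φ ∨ Sat V I ψ := Iff.rfl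

@[simp] theorem sat_conj : Sat V I (conj φ ψ) ↔ Sat V I φ ∧ Sat V I ψ := by
  simp [conj, not_or]

@[simp] theorem sat_imp : Sat V I (imp φ ψ) ↔ (Sat V I φ → Sat V I ψ) := by
  simp [imp, imp_iff_not_or]

theorem sat_diaA : Sat V I (diaA φ) ↔ ∃ z, ∃ h : I.snd ≤ z, Sat V ⟨(I.snd, z), h⟩ φ := by
  constructor
  · rintro ⟨⟨⟨x, z⟩, h⟩, e, hs⟩
    dsimp only at e
    subst e
    exact ⟨z, h, hs⟩
  · rintro ⟨z, h, hs⟩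
    exact ⟨_, rfl, hs⟩

theorem sat_boxA : Sat V I (boxA φ) ↔ ∀ z, ∀ h : I.snd ≤ z, Sat V ⟨(I.snd, z), h⟩ φ := by
  simp [boxA, sat_diaA]

theorem sat_diaB : Sat V I (diaB φ) ↔
    ∃ z, ∃ h : I.fst ≤ z, z < I.snd ∧ Sat V ⟨(I.fst, z), h⟩ φ := by
  constructor
  · rintro ⟨⟨⟨x, z⟩, h⟩, e, hs⟩
    dsimp only at e
    subst e
    exact ⟨z, h, hs⟩
  · rintro ⟨z, h, hz, hs⟩
    exact ⟨⟨(I.fst, z), h⟩, rfl, hz, hs⟩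

theorem sat_diaBbar : Sat V I (diaBbar φ) ↔
    ∃ z, ∃ h : I.fst ≤ z, I.snd < z ∧ Sat V ⟨(I.fst, z), h⟩ φ := by
  constructor
  · rintro ⟨⟨⟨x, z⟩, h⟩, e, hs⟩
    dsimp only at e
    subst e
    exact ⟨z, h, hs⟩
  · rintro ⟨z, h, hz, hs⟩
    exact ⟨⟨(I.fst, z), h⟩, rfl, hz, hs⟩

@[simp] theorem sat_bigConj {l : List ABBFormula} :
    Sat V I (bigConj l) ↔ ∀ φ ∈ l, Sat V I φ := by
  induction l with
  | nil => simp [bigConj]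
  | cons φ l ih => simp [bigConj, ih]

@[simp] theorem sat_iConj {ι : Type} [Fintype ι] {F : ι → ABBFormula} :
    Sat V I (iConj F) ↔ ∀ i, Sat V I (F i) := by
  simp [iConj]

end Sat

/-! ### Measuring intervals -/

/-- The interval has length at least `n`. -/
def lengthGe : ℕ → ABBFormula
  | 0 => top
  | n + 1 => diaB (lengthGe n)

/-- The interval has length exactly `n`. -/
def lengthEq (n : ℕ) : ABBFormula := conj (lengthGe n) (neg (lengthGe (n + 1)))

variable {V : NonemptyInterval ℕ → Set ℕ} {I : NonemptyInterval ℕ}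

@[simp] theorem sat_lengthGe {n : ℕ} : Sat V I (lengthGe n) ↔ I.fst + n ≤ I.snd := by
  induction n generalizing I with
  | zero => simpa [lengthGe] using I.fst_le_snd
  | succ n ih =>
    rw [lengthGe, sat_diaB]
    constructor
    · rintro ⟨z, h, hz, hs⟩
      have : I.fst + n ≤ z := ih.1 hs
      omega
    · intro h
      exact ⟨I.fst + n, Nat.le_add_right _ _, by omega, ih.2 le_rfl⟩

@[simp] theorem sat_lengthEq {n : ℕ} : Sat V I (lengthEq n) ↔ I.snd = I.fst + n := by
  simp only [lengthEq, sat_conj, sat_neg, sat_lengthGe]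
  omega

/-! ### Challenged columns

Spoiler challenges the column `y` by labeling an interval `[y, z]` with the letter `0`. -/

/-- The column `y` is challenged. -/
def Challenged (V : NonemptyInterval ℕ → Set ℕ) (y : ℕ) : Prop := ∃ J, J.fst = y ∧ 0 ∈ V J

/-- The label of `[x, y]` contains `p`. -/
def At (V : NonemptyInterval ℕ → Set ℕ) (p x y : ℕ) : Prop := ∃ h : x ≤ y, p ∈ V ⟨(x, y), h⟩

/-- The right endpoint is a challenged column. -/
def challenge : ABBFormula := diaA (letter 0)

@[simp] theorem sat_challenge : Sat V I challenge ↔ Challenged V I.snd :=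
  exists_congr fun _ => and_congr_left fun _ => eq_comm

/-- At most one column is challenged. -/
def oneChallenge : ABBFormula :=
  neg (diaA (conj challenge (diaA (conj (lengthGe 1) challenge))))

theorem sat_oneChallenge : Sat V (NonemptyInterval.pure 0) oneChallenge ↔
    ∀ y z, Challenged V y → Challenged V z → y = z := by
  simp only [oneChallenge, sat_neg, sat_diaA, sat_conj, sat_challenge, sat_lengthGe]
  constructor
  · intro h y z hy hz
    by_contra hne
    rcases Nat.lt_or_gt_of_ne hne with hlt | hlt
    · exact h ⟨y, Nat.zero_le y, hy, z, hlt.le, hlt, hz⟩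
    · exact h ⟨z, Nat.zero_le z, hz, y, hlt.le, hlt, hy⟩
  · rintro h ⟨y, -, hy, z, -, hlt, hz⟩
    have := h y z hy hz
    omega

/-- In the row of the right endpoint, the letter `p` holds at the challenged column (if any). -/
def now (p : ℕ) : ABBFormula := boxA (imp challenge (letter p))

/-- The interval ends just before the challenged column. -/
def beforeChallenge : ABBFormula := conj (diaBbar challenge) (neg (diaBbar (diaBbar challenge)))

/-- In the row of the right endpoint, `φ` holds just before the challenged column. -/
def prev (φ : ABBFormula) : ABBFormula := diaA (conj beforeChallenge φ)

/-- The formula holds on an interval ending one point later. -/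
def next (φ : ABBFormula) : ABBFormula := diaA (conj (lengthEq 1) φ)

theorem exists_challenged_of_sat_prev {φ : ABBFormula} (h : Sat V I (prev φ)) :
    ∃ y, Challenged V y := by
  simp only [prev, sat_diaA, beforeChallenge, sat_conj, sat_diaBbar, sat_challenge] at h
  obtain ⟨_, _, ⟨⟨y, _, _, h⟩, _⟩, _⟩ := h
  exact ⟨y, h⟩

theorem sat_next {φ : ABBFormula} : Sat V I (next φ) ↔
    Sat V ⟨(I.snd, I.snd + 1), Nat.le_succ _⟩ φ := by
  simp only [next, sat_diaA, sat_conj, sat_lengthEq]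
  constructor
  · rintro ⟨z, h, e, hs⟩
    subst e
    exact hs
  · exact fun h => ⟨_, Nat.le_succ _, rfl, h⟩

/-! ### Meaning of the row formulas when exactly one column is challenged -/

section Unique

variable {y : ℕ}

theorem sat_now (hy : ∀ z, Challenged V z ↔ z = y) {p : ℕ} : Sat V I (now p) ↔ (I.snd ≤ y → At V p I.snd y) := by
  simp only [now, sat_boxA, sat_imp, sat_challenge, hy]
  constructor
  · exact fun h hle => ⟨hle, h y hle rfl⟩
  · rintro h z hz rfl
    exact (h hz).2

theorem sat_beforeChallenge (hy : ∀ z, Challenged V z ↔ z = y) : Sat V I beforeChallenge ↔ I.snd + 1 = y := by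
  have h0 := I.fst_le_snd
  simp only [beforeChallenge, sat_conj, sat_neg, sat_diaBbar, sat_challenge, hy]
  constructor
  · rintro ⟨⟨z, h, hz, rfl⟩, hn⟩
    by_contra hne
    exact hn ⟨I.snd + 1, by omega, by omega, z, h, by omega, rfl⟩
  · rintro rfl
    refine ⟨⟨I.snd + 1, by omega, Nat.lt_succ_self _, rfl⟩, ?_⟩
    rintro ⟨z, h, hz, w, hw, hlt, e⟩
    omega

theorem sat_prev_letter (hy : ∀ z, Challenged V z ↔ z = y) {p : ℕ} :
    Sat V I (prev (letter p)) ↔ ∃ z, z + 1 = y ∧ At V p I.snd z := by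
  simp only [prev, sat_diaA, sat_conj, sat_beforeChallenge hy]
  constructor
  · rintro ⟨z, h, e, hs⟩
    exact ⟨z, e, h, hs⟩
  · rintro ⟨z, e, h, hs⟩
    exact ⟨z, h, e, hs⟩

theorem sat_prev_top (hy : ∀ z, Challenged V z ↔ z = y) : Sat V I (prev top) ↔ I.snd < y := by
  simp only [prev, sat_diaA, sat_conj, sat_beforeChallenge hy]
  constructor
  · rintro ⟨z, h, e, -⟩
    omega
  · intro h
    exact ⟨y - 1, by omega, by omega, sat_top⟩

end Unique

end ABBFormula

/-! ### The formula of a two-stack machine -/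

namespace StackMachine

open ABBFormula ABBSynthesis

variable {κ Γ : Type} (ℓ : κ ⊕ Bool × Γ → ℕ)

/-- The letter for the control state `k`. -/
def ctl (k : κ) : ℕ := ℓ (.inl k) + 1

/-- The letter for the symbol `a` of stack `d`. -/
def sym (d : Bool) (a : Γ) : ℕ := ℓ (.inr (d, a)) + 1

open Classical in
/-- Just before the challenged column, the row of the right endpoint shows the symbol `a` of
stack `d`; cells outside of the triangle count as blank. -/
noncomputable def prevSym (b : Γ) (d : Bool) (a : Γ) : ABBFormula :=
  disj (prev (letter (sym ℓ d a))) (if a = b then neg (prev top) else neg top)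

variable [Fintype κ] [Fintype Γ]

/-- The challenged column shows a successor of a configuration with control state `k`. -/
noncomputable def actionRule (b : Γ) : Option (StackAction κ Γ) → ABBFormula
  | none => neg top
  | some (.stay k) =>
    conj (now (ctl ℓ k)) (boxA (iConj fun p : Bool × Γ =>
      imp (prevSym ℓ b p.1 p.2) (now (sym ℓ p.1 p.2))))
  | some (.move d s f) =>
    conj (now (sym ℓ (!d) s)) (conj
      (iConj fun a => imp (prevSym ℓ b d a) (now (ctl ℓ (f a))))
      -- `boxA` ranges over all rows `x`. The pushed stack moves from row `x` to `x + 1`, the popped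
      -- one from `x + 1` to `x`.
      (boxA (iConj fun a => conj
        (imp (prevSym ℓ b (!d) a) (next (now (sym ℓ (!d) a))))
        (imp (next (prevSym ℓ b d a)) (now (sym ℓ d a))))))

/-- The transition between the two columns at the challenge is correct. -/
noncomputable def stepRule (δ : κ → Option (StackAction κ Γ)) (b : Γ) : ABBFormula :=
  iConj fun k => imp (prev (letter (ctl ℓ k))) (actionRule ℓ b (δ k))

omit [Fintype κ] [Fintype Γ] in
/-- The column `n`, if challenged, shows the initial configuration on input `n`. -/
def initRule (k₀ : κ) (b r a : Γ) (n : ℕ) : ABBFormula :=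
  imp (diaA (conj challenge (lengthEq n))) (conj (now (ctl ℓ k₀)) (conj (now (sym ℓ true r))
    (conj (boxA (now (sym ℓ false b))) (boxA (imp (lengthGe 1) (now (sym ℓ true a)))))))

/-- The formula expressing that the machine runs forever on input `n`. -/
noncomputable def runFormula (δ : κ → Option (StackAction κ Γ)) (k₀ : κ) (b r a : Γ) (n : ℕ) :
    ABBFormula :=
  imp oneChallenge (conj (initRule ℓ k₀ b r a n) (stepRule ℓ δ b))

variable {ℓ} {V : NonemptyInterval ℕ → Set ℕ} {I : NonemptyInterval ℕ} {y : ℕ} {b : Γ}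

omit [Fintype κ] [Fintype Γ] in
theorem sat_prevSym (hy : ∀ z, Challenged V z ↔ z = y + 1) {d : Bool} {a : Γ} :
    Sat V I (prevSym ℓ b d a) ↔ At V (sym ℓ d a) I.snd y ∨ (a = b ∧ y < I.snd) := by
  rw [prevSym, sat_disj, sat_prev_letter hy]
  refine or_congr ⟨?_, fun h => ⟨y, rfl, h⟩⟩ ?_
  · rintro ⟨z, e, h⟩
    rwa [← Nat.succ_injective e]
  · split_ifs with h
    · rw [sat_neg, sat_prev_top hy]
      simp only [h, true_and]
      omega
    · simp [h]

/-! ### Columns that show a configuration -/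

/-- The column `y` shows (at least) the configuration `c`, and all cells of `c` outside of the
triangle are blank. -/
structure Shows (ℓ : κ ⊕ Bool × Γ → ℕ) (V : NonemptyInterval ℕ → Set ℕ) (b : Γ) (y : ℕ)
    (c : Cfg κ Γ) : Prop where
  ctl : At V (ctl ℓ c.1) 0 y
  sym : ∀ d x, x ≤ y → At V (sym ℓ d (c.2 d x)) x y
  blank : ∀ d x, y < x → c.2 d x = b

theorem At.congr {V W : NonemptyInterval ℕ → Set ℕ} {m : ℕ}
    (h : ∀ I p, p ≠ 0 → I.snd ≤ m → (p ∈ V I ↔ p ∈ W I)) {p x y : ℕ} (hp : p ≠ 0) (hy : y ≤ m) :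
    At V p x y ↔ At W p x y :=
  exists_congr fun _ => h _ _ hp hy

omit [Fintype κ] [Fintype Γ] in
theorem Shows.congr {V W : NonemptyInterval ℕ → Set ℕ} {m : ℕ}
    (h : ∀ I p, p ≠ 0 → I.snd ≤ m → (p ∈ V I ↔ p ∈ W I)) {y : ℕ} (hy : y ≤ m) {c : Cfg κ Γ} :
    Shows ℓ V b y c ↔ Shows ℓ W b y c :=
  ⟨fun H => ⟨(At.congr h (Nat.succ_ne_zero _) hy).1 H.ctl,
      fun d x hx => (At.congr h (Nat.succ_ne_zero _) hy).1 (H.sym d x hx), H.blank⟩,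
    fun H => ⟨(At.congr h (Nat.succ_ne_zero _) hy).2 H.ctl,
      fun d x hx => (At.congr h (Nat.succ_ne_zero _) hy).2 (H.sym d x hx), H.blank⟩⟩

-- The bound grows by one, exactly as the column does, so no nonblank cell leaves the triangle.
omit [Fintype Γ] in
theorem shift_blank {d : Bool} {s : Γ} {T : Bool → ℕ → Γ} (h : ∀ d x, y < x → T d x = b)
    (e : Bool) (x : ℕ) (hx : y + 1 < x) : shift d s T e x = b := by
  rcases x with _ | x
  · omega
  · rw [shift]
    split_ifs
    · exact h _ _ (by omega)
    · exact h _ _ (by omega)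

/-- A challenged column continues the computation shown in the previous column. -/
theorem Shows.exists_step {δ : κ → Option (StackAction κ Γ)} {c : Cfg κ Γ}
    (hc : Shows ℓ V b y c) (hy : ∀ z, Challenged V z ↔ z = y + 1)
    (hs : Sat V (NonemptyInterval.pure 0) (stepRule ℓ δ b)) :
    ∃ c', step δ c = some c' ∧ Shows ℓ V b (y + 1) c' := by
  have hprev : ∀ (I : NonemptyInterval ℕ) d, Sat V I (prevSym ℓ b d (c.2 d I.snd)) := by
    intro I d
    rw [sat_prevSym hy]
    rcases le_or_gt I.snd y with h | h
    · exact Or.inl (hc.sym d _ h)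
    · exact Or.inr ⟨hc.blank d _ h, h⟩
  -- Extra letters in the column do no harm: the rule is an implication for each control state, and
  -- the one for the true state fires.
  have hact := (sat_imp.1 (sat_iConj.1 hs c.1)) ((sat_prev_letter hy).2 ⟨y, rfl, hc.ctl⟩)
  rcases hδ : δ c.1 with _ | k | ⟨d, s, f⟩
  · rw [hδ, actionRule] at hact
    exact absurd sat_top hact
  · rw [hδ, actionRule, sat_conj, sat_now hy, sat_boxA] at hact
    refine ⟨(k, c.2), by simp [step, hδ], hact.1 (Nat.zero_le _), fun d x hx => ?_,
      fun d x hx => hc.blank d x (by omega)⟩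
    have := sat_imp.1 (sat_iConj.1 (hact.2 x (Nat.zero_le x)) (d, c.2 d x)) (hprev _ d)
    rw [sat_now hy] at this
    exact this hx
  · rw [hδ, actionRule, sat_conj, sat_conj, sat_now hy, sat_boxA, sat_iConj] at hact
    obtain ⟨h1, h2, h3⟩ := hact
    refine ⟨(f (c.2 d 0), shift d s c.2), by simp [step, hδ], ?_, fun e x hx => ?_,
      shift_blank hc.blank⟩
    · exact (sat_now hy).1 (sat_imp.1 (h2 _) (hprev (NonemptyInterval.pure 0) d)) (Nat.zero_le _)
    · dsimp only
      by_cases hed : e = d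
      · subst hed
        have := (sat_conj.1 (sat_iConj.1 (h3 x (Nat.zero_le x)) (c.2 e (x + 1)))).2
        rw [sat_imp, sat_next, sat_now hy] at this
        simpa [shift] using this (hprev _ e) hx
      · obtain rfl : e = !d := by cases e <;> cases d <;> simp_all
        rcases x with _ | x
        · simpa [shift] using h1 (Nat.zero_le _)
        · have := (sat_conj.1 (sat_iConj.1 (h3 x (Nat.zero_le x)) (c.2 (!d) x))).1
          rw [sat_imp, sat_next, sat_now hy] at this
          simpa [shift] using this (hprev _ _) hx

omit [Fintype κ] [Fintype Γ] in
/-- If the challenged column is `n`, then it shows the initial configuration. -/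
theorem shows_init {k₀ : κ} {r a : Γ} {n : ℕ} (hn : ∀ z, Challenged V z ↔ z = n)
    (hs : Sat V (NonemptyInterval.pure 0) (initRule ℓ k₀ b r a n)) :
    Shows ℓ V b n (k₀, initStacks b r a n) := by
  have hpre : Sat V (NonemptyInterval.pure 0) (diaA (conj challenge (lengthEq n))) := by
    rw [sat_diaA]
    refine ⟨n, Nat.zero_le _, ?_⟩
    rw [sat_conj, sat_challenge, hn, sat_lengthEq]
    exact ⟨rfl, (Nat.zero_add n).symm⟩
  have h := sat_imp.1 hs hpre
  rw [sat_conj, sat_conj, sat_conj, sat_now hn, sat_now hn, sat_boxA, sat_boxA] at h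
  obtain ⟨h1, h2, h3, h4⟩ := h
  refine ⟨h1 (Nat.zero_le _), fun d x hx => ?_, fun d x hx => ?_⟩
  · cases d
    · simpa [initStacks] using (sat_now hn).1 (h3 x (Nat.zero_le x)) hx
    · rcases Nat.eq_zero_or_pos x with rfl | hpos
      · simpa [initStacks] using h2 (Nat.zero_le _)
      · have := (sat_now hn).1 (sat_imp.1 (h4 x (Nat.zero_le x)) (sat_lengthGe.2 (by
          change 0 + 1 ≤ x; omega))) hx
        simpa [initStacks, hpos.ne', hx] using this
  · simp only [initStacks]
    split_ifs <;> first | rfl | omega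

/-! ### From a winning strategy to an infinite run -/

theorem not_halts_of_admitsSynthesis {δ : κ → Option (StackAction κ Γ)} {k₀ : κ} {r a : Γ} {n : ℕ}
    (h : AdmitsSynthesis (runFormula ℓ δ k₀ b r a n) {letter 0}) :
    ¬ Halts δ (k₀, initStacks b r a n) := by
  obtain ⟨D, hD⟩ := exists_labeling_of_admitsSynthesis h
  -- Each column `y` gets its own model, in which it is the only challenged one; all these models
  -- agree with `D` up to column `y`.
  have key : ∀ y, ∃ V : NonemptyInterval ℕ → Set ℕ, (∀ z, Challenged V z ↔ z = y) ∧
      Sat V (NonemptyInterval.pure 0) (initRule ℓ k₀ b r a n) ∧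
      Sat V (NonemptyInterval.pure 0) (stepRule ℓ δ b) ∧
      ∀ I p, p ≠ 0 → I.snd ≤ y → (p ∈ V I ↔ p ∈ D I) := by
    intro y
    obtain ⟨V, hsat, h0, hV⟩ := hD y
    have hch : ∀ z, Challenged V z ↔ z = y := by
      intro z
      simp only [Challenged, h0]
      exact ⟨by rintro ⟨_, rfl, rfl⟩; rfl, by rintro rfl; exact ⟨_, rfl, rfl⟩⟩
    have := sat_imp.1 hsat (sat_oneChallenge.2 fun z w hz hw =>
      ((hch z).1 hz).trans ((hch w).1 hw).symm)
    rw [sat_conj] at this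
    exact ⟨V, hch, this.1, this.2, hV⟩
  have hreach : ∀ c, StateTransition.Reaches (step δ) (k₀, initStacks b r a n) c →
      ∃ y, Shows ℓ D b y c := by
    intro c hc
    induction hc with
    | refl =>
      obtain ⟨V, hch, hinit, -, hV⟩ := key n
      exact ⟨n, (Shows.congr hV le_rfl).1 (shows_init hch hinit)⟩
    | tail _ hstep ih =>
      obtain ⟨y, hy⟩ := ih
      obtain ⟨V, hch, -, hs, hV⟩ := key (y + 1)
      obtain ⟨c', h1, h2⟩ := ((Shows.congr hV (Nat.le_succ y)).2 hy).exists_step hch hs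
      obtain rfl := Option.mem_unique h1 hstep
      exact ⟨y + 1, (Shows.congr hV le_rfl).1 h2⟩
  intro hhalt
  obtain ⟨c, hc⟩ := Part.dom_iff_mem.1 hhalt
  obtain ⟨hr, hn⟩ := StateTransition.mem_eval.1 hc
  obtain ⟨y, hy⟩ := hreach c hr
  -- A challenge of the next column would force a successor of the halting configuration.
  obtain ⟨V, hch, -, hs, hV⟩ := key (y + 1)
  obtain ⟨c', h1, -⟩ := ((Shows.congr hV (Nat.le_succ y)).2 hy).exists_step hch hs
  simp [hn] at h1

end StackMachine

/-! ### From an infinite run to a winning strategy -/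

namespace StackMachine

open ABBFormula ABBSynthesis

variable {κ Γ : Type} {ℓ : κ ⊕ Bool × Γ → ℕ} {V : NonemptyInterval ℕ → Set ℕ} {b : Γ}

/-- The labeling that shows the run `c` from column `n` on. -/
def runLabeling (ℓ : κ ⊕ Bool × Γ → ℕ) (c : ℕ → Cfg κ Γ) (n : ℕ) (I : NonemptyInterval ℕ) :
    Set ℕ :=
  {p | n ≤ I.snd ∧ ((I.fst = 0 ∧ p = ctl ℓ (c (I.snd - n)).1) ∨
    ∃ d, p = sym ℓ d ((c (I.snd - n)).2 d I.fst))}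

theorem at_ctl_iff (hℓ : Function.Injective ℓ) {c : ℕ → Cfg κ Γ} {n : ℕ}
    (hV : ∀ I p, p ≠ 0 → (p ∈ V I ↔ p ∈ runLabeling ℓ c n I)) {k : κ} {y : ℕ} :
    At V (ctl ℓ k) 0 y ↔ ∃ t, y = n + t ∧ k = (c t).1 := by
  have : ∀ h : 0 ≤ y, ctl ℓ k ∈ runLabeling ℓ c n ⟨(0, y), h⟩ ↔ n ≤ y ∧ k = (c (y - n)).1 := by
    intro h
    simp [runLabeling, ctl, sym, hℓ.eq_iff]
  constructor
  · rintro ⟨h, hp⟩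
    rw [hV _ (ctl ℓ k) (Nat.succ_ne_zero _), this] at hp
    exact ⟨y - n, by omega, hp.2⟩
  · rintro ⟨t, rfl, rfl⟩
    refine ⟨Nat.zero_le _, ?_⟩
    rw [hV _ (ctl ℓ _) (Nat.succ_ne_zero _), this]
    simp

/-- Injectivity of `ℓ` makes the labeling exact: a cell shows one symbol per stack, so the premises
of the rules determine the configuration. -/
theorem at_sym_iff (hℓ : Function.Injective ℓ) {c : ℕ → Cfg κ Γ} {n : ℕ}
    (hV : ∀ I p, p ≠ 0 → (p ∈ V I ↔ p ∈ runLabeling ℓ c n I)) {d : Bool} {a : Γ} {x t : ℕ} :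
    At V (sym ℓ d a) x (n + t) ↔ x ≤ n + t ∧ a = (c t).2 d x := by
  have : ∀ h : x ≤ n + t, sym ℓ d a ∈ runLabeling ℓ c n ⟨(x, n + t), h⟩ ↔ a = (c t).2 d x := by
    intro h
    cases d <;> simp [runLabeling, ctl, sym, hℓ.eq_iff]
  rw [At, ← exists_prop]
  exact exists_congr fun h => by rw [hV _ (sym ℓ d a) (Nat.succ_ne_zero _), this]

theorem run_blank {δ : κ → Option (StackAction κ Γ)} {k₀ : κ} {r a : Γ} {n : ℕ}
    {c : ℕ → Cfg κ Γ} (h0 : c 0 = (k₀, initStacks b r a n))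
    (hc : ∀ t, step δ (c t) = some (c (t + 1))) (t : ℕ) (d : Bool) (x : ℕ) (hx : n + t < x) :
    (c t).2 d x = b := by
  induction t generalizing d x with
  | zero =>
    rw [h0]
    simp only [initStacks]
    split_ifs <;> first | rfl | omega
  | succ t ih =>
    have h := hc t
    rcases e : δ (c t).1 with _ | k | ⟨d', s, f⟩
    · simp [step, e] at h
    · simp only [step, e, Option.map_some, Option.some.injEq] at h
      rw [← h]
      exact ih d x (by omega)
    · simp only [step, e, Option.map_some, Option.some.injEq] at h
      rw [← h]
      exact shift_blank (y := n + t) ih d x (by omega)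

variable [Fintype κ] [Fintype Γ]

theorem admitsSynthesis_of_not_halts (hℓ : Function.Injective ℓ)
    {δ : κ → Option (StackAction κ Γ)} {k₀ : κ} {r a : Γ} {n : ℕ}
    (h : ¬ Halts δ (k₀, initStacks b r a n)) :
    AdmitsSynthesis (runFormula ℓ δ k₀ b r a n) {letter 0} := by
  obtain ⟨c, h0, hc⟩ := (not_halts_iff_exists_run _ _).1 h
  refine admitsSynthesis_of_labeling (runLabeling ℓ c n) fun V hV => ?_
  rw [runFormula, sat_imp, sat_oneChallenge]
  intro hone
  have huniq : ∀ y, Challenged V y → ∀ z, Challenged V z ↔ z = y := fun y hy z =>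
    ⟨fun hz => hone z y hz hy, fun e => e ▸ hy⟩
  rw [sat_conj]
  constructor
  · rw [initRule, sat_imp, sat_diaA]
    rintro ⟨y, hy, hch⟩
    rw [sat_conj, sat_challenge, sat_lengthEq] at hch
    obtain rfl : y = n := hch.2.trans (Nat.zero_add n)
    have hy := huniq y hch.1
    have hsym : ∀ d s x, s = initStacks b r a y d x → x ≤ y → At V (sym ℓ d s) x y := by
      intro d s x hs hx
      refine (at_sym_iff (t := 0) hℓ hV).2 ⟨hx, ?_⟩
      rw [hs, h0]
    rw [sat_conj, sat_conj, sat_conj, sat_now hy, sat_now hy, sat_boxA, sat_boxA]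
    refine ⟨fun _ => (at_ctl_iff hℓ hV).2 ⟨0, rfl, by rw [h0]⟩, fun _ => hsym _ _ _ (by
      simp [initStacks]) (Nat.zero_le _), fun x _ => (sat_now hy).2 (hsym _ _ _ (by
      simp [initStacks])), fun x _ => sat_imp.2 fun hx => (sat_now hy).2 fun hxy =>
      hsym _ _ _ ?_ hxy⟩
    rw [sat_lengthGe] at hx
    have hx : 0 + 1 ≤ x := hx
    have hxy : x ≤ y := hxy
    simp [initStacks, hxy, show x ≠ 0 by omega]
  · rw [stepRule, sat_iConj]
    intro k
    rw [sat_imp]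
    intro hp
    obtain ⟨y, hch⟩ := exists_challenged_of_sat_prev hp
    have hy := huniq y hch
    -- The column before the challenge carries a control letter. Columns before `n` are unlabeled,
    -- so it is column `n + t` for some `t` and shows `c t`.
    obtain ⟨z, rfl, hz⟩ := (sat_prev_letter hy).1 hp
    obtain ⟨t, rfl, rfl⟩ := (at_ctl_iff hℓ hV).1 hz
    have hprev : ∀ {I : NonemptyInterval ℕ} {d s}, Sat V I (prevSym ℓ b d s) →
        s = (c t).2 d I.snd := by
      intro I d s hs
      rw [sat_prevSym hy, at_sym_iff hℓ hV] at hs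
      rcases hs with hs | ⟨rfl, hlt⟩
      · exact hs.2
      -- Outside the triangle the rule reads a blank, which is the actual content of that cell.
      · exact (run_blank h0 hc t d _ hlt).symm
    have hctl : ∀ k, k = (c (t + 1)).1 → At V (ctl ℓ k) 0 (n + t + 1) := fun k hk =>
      (at_ctl_iff hℓ hV).2 ⟨t + 1, rfl, hk⟩
    have hsym : ∀ d s x, s = (c (t + 1)).2 d x → x ≤ n + t + 1 →
        At V (sym ℓ d s) x (n + t + 1) := fun d s x hs hx =>
      (at_sym_iff (t := t + 1) hℓ hV).2 ⟨hx, hs⟩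
    have hstep := hc t
    rcases e : δ (c t).1 with _ | k | ⟨d, s, f⟩
    · simp [step, e] at hstep
    · simp only [step, e, Option.map_some, Option.some.injEq] at hstep
      rw [actionRule, sat_conj, sat_now hy, sat_boxA]
      refine ⟨fun _ => hctl _ (by rw [← hstep]), fun x _ => sat_iConj.2 fun p => sat_imp.2
        fun hps => (sat_now hy).2 (hsym _ _ _ ?_)⟩
      rw [← hstep]
      exact hprev hps
    · simp only [step, e, Option.map_some, Option.some.injEq] at hstep
      rw [actionRule, sat_conj, sat_conj, sat_now hy, sat_boxA, sat_iConj]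
      refine ⟨fun _ => hsym _ _ _ (by rw [← hstep]; simp [shift]) (Nat.zero_le _),
        fun s' => sat_imp.2 fun hps => (sat_now hy).2 fun _ => hctl _ ?_,
        fun x _ => sat_iConj.2 fun s' => sat_conj.2 ⟨sat_imp.2 fun hps => sat_next.2
          ((sat_now hy).2 (hsym _ _ _ ?_)), sat_imp.2 fun hps => (sat_now hy).2
          (hsym _ _ _ ?_)⟩⟩
      · rw [← hstep, hprev hps]
        rfl
      · rw [← hstep, hprev hps]
        simp [shift]
      · rw [hprev (sat_next.1 hps), ← hstep]
        simp [shift]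

theorem positiveInstance_runFormula_iff (hℓ : Function.Injective ℓ)
    (δ : κ → Option (StackAction κ Γ)) (k₀ : κ) (b r a : Γ) (n : ℕ) :
    PositiveInstance (runFormula ℓ δ k₀ b r a n, [letter 0]) ↔
      ¬ Halts δ (k₀, initStacks b r a n) := by
  have hset : {ψ | ψ ∈ [letter 0]} = {letter 0} := by
    ext
    simp
  rw [PositiveInstance, hset]
  refine ⟨fun h => not_halts_of_admitsSynthesis h.2, fun h => ⟨fun ψ hψ => ?_,
    admitsSynthesis_of_not_halts hℓ h⟩⟩
  obtain rfl := List.mem_singleton.1 hψ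
  refine Or.inl ⟨?_, 0, rfl⟩
  simp [runFormula, imp, oneChallenge, conj, challenge, subformulas]

/-! ### Computability of the reduction -/

theorem primrec_neg : Primrec ABBFormula.neg := by
  have h : Primrec fun n : ℕ => 6 * n + 1 :=
    Primrec.succ.comp (Primrec.nat_mul.comp (Primrec.const 6) Primrec.id)
  exact (Primrec.of_equiv_symm (e := codeEquiv)).comp (h.comp (Primrec.of_equiv (e := codeEquiv)))
    |>.of_eq fun φ => decode_code (neg φ)

theorem primrec_diaA : Primrec ABBFormula.diaA := by
  have h : Primrec fun n : ℕ => 6 * n + 3 :=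
    Primrec.nat_add.comp (Primrec.nat_mul.comp (Primrec.const 6) Primrec.id) (Primrec.const 3)
  exact (Primrec.of_equiv_symm (e := codeEquiv)).comp (h.comp (Primrec.of_equiv (e := codeEquiv)))
    |>.of_eq fun φ => decode_code (diaA φ)

theorem primrec_diaB : Primrec ABBFormula.diaB := by
  have h : Primrec fun n : ℕ => 6 * n + 4 :=
    Primrec.nat_add.comp (Primrec.nat_mul.comp (Primrec.const 6) Primrec.id) (Primrec.const 4)
  exact (Primrec.of_equiv_symm (e := codeEquiv)).comp (h.comp (Primrec.of_equiv (e := codeEquiv)))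
    |>.of_eq fun φ => decode_code (diaB φ)

theorem primrec_disj : Primrec₂ ABBFormula.disj := by
  have h : Primrec fun p : ℕ × ℕ => 6 * Nat.pair p.1 p.2 + 2 :=
    Primrec.nat_add.comp (Primrec.nat_mul.comp (Primrec.const 6)
      (Primrec₂.natPair.comp Primrec.fst Primrec.snd)) (Primrec.const 2)
  exact ((Primrec.of_equiv_symm (e := codeEquiv)).comp (h.comp
    (((Primrec.of_equiv (e := codeEquiv)).comp Primrec.fst).pair
      ((Primrec.of_equiv (e := codeEquiv)).comp Primrec.snd)))).of_eq
    fun p => decode_code (disj p.1 p.2)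

theorem primrec_conj : Primrec₂ ABBFormula.conj :=
  primrec_neg.comp (primrec_disj.comp (primrec_neg.comp Primrec.fst)
    (primrec_neg.comp Primrec.snd))

theorem primrec_imp : Primrec₂ ABBFormula.imp :=
  primrec_disj.comp (primrec_neg.comp Primrec.fst) Primrec.snd

theorem primrec_lengthGe : Primrec lengthGe :=
  (Primrec.nat_rec₁ (f := fun _ φ => diaB φ) top (primrec_diaB.comp Primrec.snd)).of_eq fun n => by
    induction n with
    | zero => rfl
    | succ n ih => exact congrArg diaB ih

/-- Only `lengthEq n` depends on `n`; the rest of the formula is constant. -/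
theorem primrec_runFormula (δ : κ → Option (StackAction κ Γ)) (k₀ : κ) (b r a : Γ) :
    Primrec (runFormula ℓ δ k₀ b r a) := by
  have hlen : Primrec lengthEq := primrec_conj.comp primrec_lengthGe
    (primrec_neg.comp (primrec_lengthGe.comp Primrec.succ))
  have hinit : Primrec (initRule ℓ k₀ b r a) := primrec_imp.comp
    (primrec_diaA.comp (primrec_conj.comp (Primrec.const _) hlen)) (Primrec.const _)
  exact primrec_imp.comp (Primrec.const _) (primrec_conj.comp hinit (Primrec.const _))

end StackMachine

/-- The `ℕ`-synthesis problem for ABB is undecidable. -/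
theorem mainTheorem5 :
    ¬ ComputablePred (fun i : ABBFormula × List ABBFormula => ABBSynthesis.PositiveInstance i) := by
  obtain ⟨κ, Γ, _, _, δ, k₀, b, r, a, hund⟩ := StackMachine.exists_not_computable_halts
  intro h
  let ℓ : κ ⊕ Bool × Γ → ℕ := fun l => Fintype.equivFin _ l
  have hℓ : Function.Injective ℓ := Fin.val_injective.comp (Equiv.injective _)
  have hred : ComputablePred fun n : ℕ =>
      ¬ StackMachine.Halts δ (k₀, StackMachine.initStacks b r a n) :=
    ComputablePred.computable_of_manyOneReducible
      ⟨fun n => (StackMachine.runFormula ℓ δ k₀ b r a n, [.letter 0]),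
        ((StackMachine.primrec_runFormula δ k₀ b r a).pair (Primrec.const _)).to_comp,
        fun n => (StackMachine.positiveInstance_runFormula_iff hℓ δ k₀ b r a n).symm⟩ h
  -- The reduction is from non-halting; decidability passes to the complement.
  exact hund (hred.not.of_eq fun n => not_not)
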